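/- For $d\ge 1$ let $\mathcal H(2,d)$ be the set of real polynomials $p(x,y)$ of degree exactly $d$ with nonnegative coefficients such that $p(x,y)=1$ whenever $x+y=1$, and let $N(p)$ be the number of distinct monomials of $p$. Call $p\in\mathcal H(2,d)$ \emph{sharp} if $N(p)$ is minimal in $\mathcal H(2,d)$. Uniqueness \emph{holds} for degree $d$ if there is exactly one sharp polynomial in $\mathcal H(2,d)$ up to interchanging the variables $x$ and $y$; otherwise uniqueness \emph{fails} for $d$. For $d\ge 0$ let $$f_d(x,y)=\left(\frac{x+\sqrt{x^2+4y}}{2}\right)^d+\left(\frac{x-\sqrt{x^2+4y}}{2}\right)^d+(-1)^{d+1}y^d,$$ which is a polynomial in $x,y$. Consider the following procedure for constructing polynomials of degree $d$: (a) for odd $d$, form $f_d(x,y)-c\,x^jy^k\,(f_m(x,y)-1)$ with $m<d$ an even nonnegative integer, $j,k\ge 0$ integers and $c\in\mathbb R$; (b) for even $d$, write $d=d_1+d_2$ with $d_1,d_2$ odd, take a sharp polynomial $x^{d_1}+y^{d_1}+p_0(x,y)$ of degree $d_1$ and a sharp polynomial $q$ of degree $d_2$, and form $x^{d_1}+y^{d_1}q(x,y)+p_0(x,y)$.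 Say that the procedure produces a new sharp polynomial in degree $d$ if, for some choice of the parameters, the polynomial formed is a sharp polynomial in $\mathcal H(2,d)$ different from $f_d(x,y)$ and from $f_d(y,x)$. Let $$L=\{1,3,5,9,17,21,33,41,45,53,69,77,81,93,105,113,117,125,129,141,149\}.$$ Then uniqueness fails for every degree $1\le d\le 149$ with $d\notin L$. More precisely, $L$ is exactly the set of degrees $1\le d\le 149$ for which the procedure does not produce a new sharp polynomial. -/

import Mathlib

open MvPolynomial

noncomputable section

namespace SharpPoly

/-- Real polynomials in two variables; `X 0` is `x` and `X 1` is `y`. -/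
abbrev Poly := MvPolynomial (Fin 2) ℝ

/-- `H(2,d)`: polynomials of degree exactly `d` with nonnegative coefficients which
are equal to `1` at every point of the line `x + y = 1`. -/
def H (d : ℕ) : Set Poly :=
  {p | p.totalDegree = d ∧ (∀ e, 0 ≤ p.coeff e) ∧
    ∀ x y : ℝ, x + y = 1 → eval ![x, y] p = 1}

/-- `N(p)`: the number of distinct monomials of `p`. -/
def numTerms (p : Poly) : ℕ := p.support.card

/-- `p` is sharp in degree `d`: it minimizes the number of terms in `H(2,d)`. -/
def IsSharp (d : ℕ) (p : Poly) : Prop :=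
  p ∈ H d ∧ ∀ q ∈ H d, numTerms p ≤ numTerms q

/-- Interchange of the variables `x` and `y`. -/
def swapVars (p : Poly) : Poly := rename (Equiv.swap (0 : Fin 2) 1) p

/-- Uniqueness holds in degree `d`: up to interchanging the variables there is
exactly one sharp polynomial in `H(2,d)`. -/
def UniquenessHolds (d : ℕ) : Prop :=
  ∃ p, IsSharp d p ∧ ∀ q, IsSharp d q → q = p ∨ q = swapVars p

/-- The polynomial `((x + √(x² + 4y)) / 2) ^ n + ((x - √(x² + 4y)) / 2) ^ n`. The two
bases are the roots of `t² = x t + y`, so it satisfies this recurrence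
(see `eval_powerSum` below). -/
def powerSum : ℕ → Poly
  | 0 => 2
  | 1 => X 0
  | n + 2 => X 0 * powerSum (n + 1) + X 1 * powerSum n

/-- The polynomial `f_d = ((x + √(x² + 4y)) / 2) ^ d + ((x - √(x² + 4y)) / 2) ^ d
+ (-1) ^ (d + 1) y ^ d`. -/
def f (d : ℕ) : Poly := powerSum d + (-1) ^ (d + 1) * X 1 ^ d

theorem eval_powerSum (x y : ℝ) (h : 0 ≤ x ^ 2 + 4 * y) (n : ℕ) :
    eval ![x, y] (powerSum n) =
      ((x + √(x ^ 2 + 4 * y)) / 2) ^ n + ((x - √(x ^ 2 + 4 * y)) / 2) ^ n := by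
  have hs : √(x ^ 2 + 4 * y) ^ 2 = x ^ 2 + 4 * y := Real.sq_sqrt h
  set s := √(x ^ 2 + 4 * y) with hs_def
  clear_value s
  have hy : y = (s ^ 2 - x ^ 2) / 4 := by linarith
  induction n using Nat.twoStepInduction with
  | zero => simp [powerSum]; norm_num
  | one => simp [powerSum]; ring
  | more n ih₁ ih₂ =>
    simp only [powerSum, map_add, map_mul, ih₁, ih₂, eval_X, Matrix.cons_val_zero,
      Matrix.cons_val_one]
    rw [hy]
    ring

theorem eval_f (x y : ℝ) (h : 0 ≤ x ^ 2 + 4 * y) (d : ℕ) :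
    eval ![x, y] (f d) =
      ((x + √(x ^ 2 + 4 * y)) / 2) ^ d + ((x - √(x ^ 2 + 4 * y)) / 2) ^ d
        + (-1) ^ (d + 1) * y ^ d := by
  simp [f, eval_powerSum x y h]

/-- For odd `d`: the candidates `f_d - c x^j y^k (f_m - 1)`, with `m < d` even, `c` a
constant and `x^j y^k` a monomial. -/
def OddCandidate (d : ℕ) (p : Poly) : Prop :=
  Odd d ∧ ∃ (m j k : ℕ) (c : ℝ), Even m ∧ m < d ∧
    p = f d - C c * X 0 ^ j * X 1 ^ k * (f m - 1)

/-- For even `d = d₁ + d₂`: the candidates `x^d₁ + y^d₁ q + p₀`, where `d₁`, `d₂` are odd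
and `r = x^d₁ + y^d₁ + p₀` and `q` are sharp of degrees `d₁` and `d₂`. -/
def EvenCandidate (d : ℕ) (p : Poly) : Prop :=
  ∃ (d₁ d₂ : ℕ) (r q p₀ : Poly), Odd d₁ ∧ Odd d₂ ∧ d = d₁ + d₂ ∧
    IsSharp d₁ r ∧ IsSharp d₂ q ∧ r = X 0 ^ d₁ + X 1 ^ d₁ + p₀ ∧
    p = X 0 ^ d₁ + X 1 ^ d₁ * q + p₀

/-- The procedure produces, in degree `d`, a sharp polynomial which is neither `f_d` nor
`f_d` with the variables interchanged. -/
def ProducesNewSharp (d : ℕ) : Prop :=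
  ∃ p, (OddCandidate d p ∨ EvenCandidate d p) ∧ IsSharp d p ∧
    p ≠ f d ∧ p ≠ swapVars (f d)

/-- The list of exceptional degrees. -/
def exceptionalDegrees : Finset ℕ :=
  {1, 3, 5, 9, 17, 21, 33, 41, 45, 53, 69, 77, 81, 93,
    105, 113, 117, 125, 129, 141, 149}

end SharpPoly

end

open MvPolynomial

noncomputable section

namespace SharpPoly

/-! ### Alternating blocks of real polynomials in one variable -/

/-! Lower bound. Write 1 - p = (1 - x - y) q. Let Q_k and P_k be the degree-k parts of q and p with
y = 1, so that Q_k = (1 + X) Q_{k-1} - P_k. Count the maximal runs of consecutive nonzero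
coefficients with alternating signs. Multiplication by 1 + X raises this count by at least one
(`card_blockStarts_lt_mul`), subtracting P_k lowers it by at most two per monomial
(`card_blockStarts_le_sub`), and Q_k vanishes at k = d but not before. This forces 2 N(p) ≥ d + 3,
which f_d attains for odd d.

Odd d. A perturbation of f_d with c ≠ 0 and m = 2s > 0 can have nonnegative coefficients only if c >
0 and d = m + 2k + j. It then gains the monomials x^j y^k and x^j y^(k+m), so it is sharp only if
two terms of f_d cancel. That means c is the minimum of the quotients R_l (`coeffQuotient`), taken
at two indices. The ratios R_{l+1} / R_l (`growth`) increase strictly, so this happens for some c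
exactly when one of them equals 1. That is an integer equation with finitely many parameters for
each d, decided by computation in `hasNewSharp_eq_notMem`.

Even d. The lower bound becomes (d + 4) / 2, and two explicit polynomials not related by the swap
attain it. -/

/-- The indices at which a maximal block of consecutive nonzero coefficients with alternating
signs begins. -/
def blockStarts (Q : Polynomial ℝ) : Finset ℕ :=
  {a ∈ Q.support | 0 ≤ (Polynomial.X * Q).coeff a * Q.coeff a}

theorem mem_blockStarts {Q : Polynomial ℝ} {a : ℕ} :
    a ∈ blockStarts Q ↔ Q.coeff a ≠ 0 ∧ 0 ≤ (Polynomial.X * Q).coeff a * Q.coeff a := by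
  simp [blockStarts]

theorem succ_mem_blockStarts {Q : Polynomial ℝ} {a : ℕ} :
    a + 1 ∈ blockStarts Q ↔ Q.coeff (a + 1) ≠ 0 ∧ 0 ≤ Q.coeff a * Q.coeff (a + 1) := by
  simp [mem_blockStarts]

theorem card_blockStarts_le (Q : Polynomial ℝ) : (blockStarts Q).card ≤ Q.support.card :=
  Finset.card_filter_le _ _

theorem exists_mem_blockStarts_le {Q : Polynomial ℝ} {p : ℕ} (hp : Q.coeff p ≠ 0) :
    ∃ b ∈ blockStarts Q, b ≤ p := by
  induction p with
  | zero => exact ⟨0, by simp [mem_blockStarts, hp], le_rfl⟩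
  | succ p ih =>
    by_cases h : Q.coeff p = 0
    · exact ⟨p + 1, by simp [succ_mem_blockStarts, hp, h], le_rfl⟩
    · obtain ⟨b, hb, hbp⟩ := ih h
      exact ⟨b, hb, by omega⟩

theorem blockStarts_nonempty {Q : Polynomial ℝ} (hQ : Q ≠ 0) : (blockStarts Q).Nonempty := by
  obtain ⟨b, hb, -⟩ := exists_mem_blockStarts_le
    (by simpa using hQ : Q.coeff Q.natDegree ≠ 0)
  exact ⟨b, hb⟩

/-- Whether a block starts at `a` depends only on the coefficients at `a` and `a - 1`, so each
monomial of `P` affects at most two positions. -/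
theorem card_blockStarts_le_sub (Q P : Polynomial ℝ) :
    (blockStarts Q).card ≤ (blockStarts (Q - P)).card + 2 * P.support.card := by
  have hsub : blockStarts Q ⊆
      blockStarts (Q - P) ∪ (P.support ∪ P.support.image (· + 1)) := by
    intro a ha
    by_cases h1 : P.coeff a = 0
    · by_cases h2 : (Polynomial.X * P).coeff a = 0
      · rw [mem_blockStarts] at ha
        refine Finset.mem_union_left _ (mem_blockStarts.2 ?_)
        simpa [mul_sub, h1, h2] using ha
      · refine Finset.mem_union_right _ (Finset.mem_union_right _ ?_)
        cases a with
        | zero => simp at h2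
        | succ a => simpa using h2
    · exact Finset.mem_union_right _ (Finset.mem_union_left _ (by simpa using h1))
  have h1 := Finset.card_le_card hsub
  have h2 := Finset.card_union_le (blockStarts (Q - P)) (P.support ∪ P.support.image (· + 1))
  have h3 := Finset.card_union_le P.support (P.support.image (· + 1))
  have h4 : (P.support.image (· + 1)).card ≤ P.support.card := Finset.card_image_le
  omega

/-- The invariant is that the product with 1 + X never has sign opposite to `Q` at the current
index. If its next coefficient z' is zero, then u' = -u. Otherwise z' has sign opposite to u, and u'
= z' - u takes the sign of z'. -/
theorem coeff_alternate_of_no_blockStarts {Q : Polynomial ℝ} {p b : ℕ} (hp : p ∈ blockStarts Q)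
    (hno : ∀ a, p < a → a ≤ b → a ∉ blockStarts ((1 + Polynomial.X) * Q)) :
    ∀ n, p + n ≤ b → Q.coeff (p + n) ≠ 0 ∧
      0 ≤ ((1 + Polynomial.X) * Q).coeff (p + n) * Q.coeff (p + n) ∧
      (n ≠ 0 → Q.coeff (p + n - 1) * Q.coeff (p + n) < 0) := by
  intro n
  induction n with
  | zero =>
    intro _
    rw [mem_blockStarts] at hp
    refine ⟨hp.1, ?_, by simp⟩
    simp only [add_zero, add_mul, one_mul, Polynomial.coeff_add]
    nlinarith [mul_self_nonneg (Q.coeff p)]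
  | succ n ih =>
    intro hb
    obtain ⟨h1, h2, -⟩ := ih (by omega)
    have h3 := hno (p + n + 1) (by omega) (by omega)
    rw [succ_mem_blockStarts] at h3
    have hz : ((1 + Polynomial.X) * Q).coeff (p + n + 1) =
        Q.coeff (p + n + 1) + Q.coeff (p + n) := by
      simp [add_mul]
    rw [← add_assoc, Nat.add_sub_cancel]
    set z := ((1 + Polynomial.X) * Q).coeff (p + n)
    set z' := ((1 + Polynomial.X) * Q).coeff (p + n + 1)
    set u := Q.coeff (p + n)
    set u' := Q.coeff (p + n + 1)
    have key : u * u' < 0 ∧ 0 ≤ z' * u' := by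
      by_cases hz0 : z' = 0
      · have : u' = -u := by linarith
        rw [this, hz0]
        exact ⟨by nlinarith [mul_self_pos.2 h1], by simp⟩
      · have hlt : z * z' < 0 := by
          by_contra h
          exact h3 ⟨hz0, not_lt.1 h⟩
        rcases lt_or_gt_of_ne h1 with hu | hu
        · have hzn : z < 0 := by
            have : z ≠ 0 := by rintro h; simp [h] at hlt
            by_contra h
            have : 0 < z := lt_of_le_of_ne (not_lt.1 h) this.symm
            nlinarith
          have hz'p : 0 < z' := by
            by_contra h
            nlinarith
          have : 0 < u' := by linarith
          exact ⟨mul_neg_of_neg_of_pos hu this, by positivity⟩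
        · have hzp : 0 < z := by
            have : z ≠ 0 := by rintro h; simp [h] at hlt
            by_contra h
            have : z < 0 := lt_of_le_of_ne (not_lt.1 h) this
            nlinarith
          have hz'n : z' < 0 := by
            by_contra h
            nlinarith
          have : u' < 0 := by linarith
          exact ⟨mul_neg_of_pos_of_neg hu this, (mul_pos_of_neg_of_neg hz'n this).le⟩
    refine ⟨?_, key.2, fun _ => key.1⟩
    intro h
    simp [h] at key

/-- Sending each element of `A` to the next larger element of `B` is injective and misses an element
of `B` that is at most min `A`. -/
theorem card_lt_card_of_interlacing {A B : Finset ℕ} (hA : A.Nonempty)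
    (h1 : ∀ p ∈ A, ∃ b ∈ B, b ≤ p) (h2 : ∀ p ∈ A, ∃ b ∈ B, p < b)
    (h3 : ∀ p ∈ A, ∀ q ∈ A, p < q → ∃ b ∈ B, p < b ∧ b ≤ q) : A.card < B.card := by
  classical
  choose! φ hφB hφlt hφmin using fun p (hp : p ∈ A) =>
    (show ∃ b, b ∈ B ∧ p < b ∧ ∀ c ∈ B, p < c → b ≤ c by
      have hne : {b ∈ B | p < b}.Nonempty := by
        obtain ⟨b, hb, hpb⟩ := h2 p hp
        exact ⟨b, by simp [hb, hpb]⟩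
      have hm := Finset.min'_mem _ hne
      rw [Finset.mem_filter] at hm
      exact ⟨_, hm.1, hm.2, fun c hc hpc => Finset.min'_le _ _ (by simp [hc, hpc])⟩)
  have hmono : ∀ p ∈ A, ∀ q ∈ A, p < q → φ p < φ q := by
    intro p hp q hq hpq
    obtain ⟨b, hb, hpb, hbq⟩ := h3 p hp q hq hpq
    exact ((hφmin p hp b hb hpb).trans hbq).trans_lt (hφlt q hq)
  have hinj : Set.InjOn φ A := by
    intro p hp q hq hpq
    rcases lt_trichotomy p q with h | h | h
    · exact absurd hpq (hmono p hp q hq h).ne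
    · exact h
    · exact absurd hpq (hmono q hq p hp h).ne'
  obtain ⟨b, hb, hbA⟩ := h1 _ (A.min'_mem hA)
  rw [← Finset.card_image_of_injOn hinj]
  refine Finset.card_lt_card ((Finset.ssubset_iff_of_subset ?_).2 ⟨b, hb, ?_⟩)
  · intro c hc
    obtain ⟨p, hp, rfl⟩ := Finset.mem_image.1 hc
    exact hφB p hp
  · intro hc
    obtain ⟨p, hp, rfl⟩ := Finset.mem_image.1 hc
    have := hφlt p hp
    have := A.min'_le p hp
    omega

theorem card_blockStarts_lt_mul {Q : Polynomial ℝ} (hQ : Q ≠ 0) :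
    (blockStarts Q).card < (blockStarts ((1 + Polynomial.X) * Q)).card := by
  apply card_lt_card_of_interlacing (blockStarts_nonempty hQ)
  · intro p hp
    apply exists_mem_blockStarts_le
    rw [mem_blockStarts] at hp
    simp only [add_mul, one_mul, Polynomial.coeff_add]
    intro h
    have h2 := hp.2
    rw [eq_neg_of_add_eq_zero_right h] at h2
    nlinarith [mul_self_pos.2 hp.1]
  · intro p hp
    by_contra! hno
    -- Without a later block start the coefficients of `Q` would alternate, hence be nonzero, beyond
    -- its degree.
    have := (coeff_alternate_of_no_blockStarts (b := p + (Q.natDegree + 1)) hp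
      (fun a ha _ hB => absurd (hno a hB) (by omega)) (Q.natDegree + 1) le_rfl).1
    exact this (Polynomial.coeff_eq_zero_of_natDegree_lt (by omega))
  · intro p hp q hq hpq
    by_contra! hno
    obtain ⟨n, rfl⟩ := Nat.exists_eq_add_of_lt hpq
    have := (coeff_alternate_of_no_blockStarts (b := p + n + 1) hp
      (fun a ha hab hB => absurd (hno a hB ha) (by omega)) (n + 1) (by omega)).2.2 (by omega)
    rw [← add_assoc, Nat.add_sub_cancel] at this
    rw [succ_mem_blockStarts] at hq
    linarith [hq.2]

/-! ### The lower bound for the number of terms -/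

/-- The part of `p` of degree `k`, with `y` set to `1`. -/
def slice (p : Poly) (k : ℕ) : Polynomial ℝ :=
  ∑ e ∈ p.support with e 0 + e 1 = k, Polynomial.monomial (e 0) (p.coeff e)

/-- The part of degree `k` of `(1 - p) / (1 - x - y)`, with `y` set to `1`. -/
def quotientSlice (p : Poly) : ℕ → Polynomial ℝ
  | 0 => 1 - slice p 0
  | k + 1 => (1 + Polynomial.X) * quotientSlice p k - slice p (k + 1)

theorem card_support_slice_le (p : Poly) (k : ℕ) :
    (slice p k).support.card ≤ {e ∈ p.support | e 0 + e 1 = k}.card := by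
  classical
  refine (Finset.card_le_card (?_ : _ ⊆ {e ∈ p.support | e 0 + e 1 = k}.image
    (fun e => e 0))).trans Finset.card_image_le
  intro a ha
  rw [Polynomial.mem_support_iff, slice, Polynomial.finsetSum_coeff] at ha
  obtain ⟨e, he, hne⟩ := Finset.exists_ne_zero_of_sum_ne_zero ha
  rw [Polynomial.coeff_monomial] at hne
  exact Finset.mem_image.2 ⟨e, he, by by_contra h; simp [h] at hne⟩

theorem degree_le_totalDegree {p : Poly} {e : Fin 2 →₀ ℕ} (he : e ∈ p.support) :
    e 0 + e 1 ≤ p.totalDegree := by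
  have := le_totalDegree he
  rwa [Finsupp.sum_fintype _ _ (by simp), Fin.sum_univ_two] at this

theorem sum_card_support_slice_le (p : Poly) (d : ℕ) :
    ∑ k ∈ Finset.range (d + 1), (slice p k).support.card ≤ numTerms p := by
  classical
  calc ∑ k ∈ Finset.range (d + 1), (slice p k).support.card
      ≤ ∑ k ∈ Finset.range (d + 1), {e ∈ p.support | e 0 + e 1 = k}.card :=
        Finset.sum_le_sum fun k _ => card_support_slice_le p k
    _ = {e ∈ p.support | e 0 + e 1 ∈ Finset.range (d + 1)}.card := by
        rw [Finset.card_eq_sum_card_fiberwise (f := fun e : Fin 2 →₀ ℕ => e 0 + e 1)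
          (s := {e ∈ p.support | e 0 + e 1 ∈ Finset.range (d + 1)})
          (t := Finset.range (d + 1)) (fun e he => (Finset.mem_filter.1 he).2)]
        refine Finset.sum_congr rfl fun k hk => ?_
        congr 1
        ext e
        simp only [Finset.mem_filter]
        exact ⟨fun h => ⟨⟨h.1, h.2 ▸ hk⟩, h.2⟩, fun h => ⟨h.1.1, h.2⟩⟩
    _ ≤ numTerms p := Finset.card_filter_le _ _

theorem eval_slice (p : Poly) (k : ℕ) (t : ℝ) : (slice p k).eval t =
    ∑ e ∈ p.support with e 0 + e 1 = k, p.coeff e * t ^ e 0 := by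
  simp [slice, Polynomial.eval_finsetSum]

theorem eval_quotientSlice (p : Poly) (k : ℕ) (t : ℝ) :
    (quotientSlice p k).eval t = (1 + t) ^ k -
      ∑ i ∈ Finset.range (k + 1), (1 + t) ^ (k - i) * (slice p i).eval t := by
  induction k with
  | zero => simp [quotientSlice]
  | succ k ih =>
    rw [quotientSlice, Finset.sum_range_succ]
    simp only [Polynomial.eval_sub, Polynomial.eval_mul, Polynomial.eval_add,
      Polynomial.eval_one, Polynomial.eval_X, ih, Nat.sub_self, pow_zero, one_mul]
    rw [mul_sub, Finset.mul_sum, ← sub_sub, pow_succ' (1 + t) k]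
    congr 2
    refine Finset.sum_congr rfl fun i hi => ?_
    have : k + 1 - i = k - i + 1 := by
      have := Finset.mem_range.1 hi
      omega
    rw [this, pow_succ', mul_assoc]

theorem sum_eval_slice {p : Poly} {d : ℕ} (hp : p ∈ H d) {t : ℝ} (ht : 0 < 1 + t) :
    ∑ i ∈ Finset.range (d + 1), (1 + t) ^ (d - i) * (slice p i).eval t = (1 + t) ^ d := by
  -- This point of the line has x / y = t; multiplying by (1 + t)^d homogenizes the identity.
  have h := hp.2.2 (t / (1 + t)) (1 / (1 + t)) (by field_simp; ring)
  rw [eval_eq'] at h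
  have h' : ∑ e ∈ p.support, (1 + t) ^ (d - (e 0 + e 1)) * (p.coeff e * t ^ e 0) =
      (1 + t) ^ d := by
    have h2 := congrArg ((1 + t) ^ d * ·) h
    simp only [Finset.mul_sum, mul_one] at h2
    rw [← h2]
    refine Finset.sum_congr rfl fun e he => ?_
    have hd : e 0 + e 1 ≤ d := hp.1 ▸ degree_le_totalDegree he
    obtain ⟨c, hc⟩ := Nat.exists_eq_add_of_le hd
    rw [hc, Nat.add_sub_cancel_left]
    simp only [Fin.prod_univ_two, Matrix.cons_val_zero, Matrix.cons_val_one]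
    rw [pow_add, pow_add, div_pow, div_pow, one_pow]
    field_simp
  rw [← h', ← Finset.sum_fiberwise_of_maps_to (g := fun e : Fin 2 →₀ ℕ => e 0 + e 1)
    (t := Finset.range (d + 1)) (fun e he => Finset.mem_range.2
      (Nat.lt_succ_of_le (hp.1 ▸ degree_le_totalDegree he)))]
  refine Finset.sum_congr rfl fun k _ => ?_
  rw [eval_slice, Finset.mul_sum]
  refine Finset.sum_congr rfl fun e he => ?_
  rw [(Finset.mem_filter.1 he).2]

theorem quotientSlice_eq_zero {p : Poly} {d : ℕ} (hp : p ∈ H d) : quotientSlice p d = 0 := by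
  apply Polynomial.eq_zero_of_infinite_isRoot
  refine (Set.Ioi_infinite (0 : ℝ)).mono fun t ht => ?_
  have ht : 0 < t := ht
  rw [Set.mem_ofPred_eq, Polynomial.IsRoot, eval_quotientSlice,
    sum_eval_slice hp (by linarith), sub_self]

/-- At t = 1, vanishing would say that the terms of degree at most `k` already sum to 1 at (1/2,
1/2). Nonnegativity of the coefficients and a positive top-degree part make the full sum larger than
1. -/
theorem quotientSlice_ne_zero {p : Poly} {d k : ℕ} (hp : p ∈ H d) (hk : k < d) :
    quotientSlice p k ≠ 0 := by
  intro h0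
  have h := eval_quotientSlice p k 1
  rw [h0, Polynomial.eval_zero] at h
  have hd := sum_eval_slice hp (t := 1) (by norm_num)
  have hnn : ∀ i, 0 ≤ (slice p i).eval 1 := fun i => by
    rw [eval_slice]
    exact Finset.sum_nonneg fun e _ => by simpa using hp.2.1 e
  have hpos : 0 < (slice p d).eval 1 := by
    rw [eval_slice]
    have hne : p.support.Nonempty := by
      rw [Finset.nonempty_iff_ne_empty, Ne, support_eq_empty]
      rintro rfl
      have := hp.1
      simp at this
      omega
    obtain ⟨e, he, hed⟩ := Finset.exists_mem_eq_sup _ hne (fun e => e.sum fun _ n => n)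
    have hed' : e 0 + e 1 = d := by
      rw [← hp.1, totalDegree, hed, Finsupp.sum_fintype _ _ (by simp), Fin.sum_univ_two]
    refine Finset.sum_pos' (fun e _ => by simpa using hp.2.1 e)
      ⟨e, by simp [hed', mem_support_iff.1 he], ?_⟩
    simpa using lt_of_le_of_ne (hp.2.1 e) (mem_support_iff.1 he).symm
  have hlt : ∑ i ∈ Finset.range (k + 1), (1 + 1 : ℝ) ^ (d - i) * (slice p i).eval 1 <
      ∑ i ∈ Finset.range (d + 1), (1 + 1 : ℝ) ^ (d - i) * (slice p i).eval 1 := by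
    refine Finset.sum_lt_sum_of_subset (i := d) (fun i hi => ?_) (by simp) (by simp; omega)
      (by positivity) (fun i _ _ => mul_nonneg (by positivity) (hnn i))
    simp only [Finset.mem_range] at hi ⊢
    omega
  have heq : ∑ i ∈ Finset.range (k + 1), (1 + 1 : ℝ) ^ (d - i) * (slice p i).eval 1 =
      (1 + 1 : ℝ) ^ (d - k) *
        ∑ i ∈ Finset.range (k + 1), (1 + 1 : ℝ) ^ (k - i) * (slice p i).eval 1 := by
    rw [Finset.mul_sum]
    refine Finset.sum_congr rfl fun i hi => ?_
    rw [← mul_assoc, ← pow_add]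
    congr 2
    have := Finset.mem_range.1 hi
    omega
  have hk' : ∑ i ∈ Finset.range (k + 1), (1 + 1 : ℝ) ^ (k - i) * (slice p i).eval 1 =
      (1 + 1) ^ k := by linarith
  rw [heq, hk', hd, ← pow_add, Nat.sub_add_cancel hk.le] at hlt
  exact lt_irrefl _ hlt

/-- Each step gains a block from 1 + X and loses at most two per monomial subtracted. The constant
term of `p` is not charged, since a nonzero `quotientSlice p 0` already has a block. -/
theorem blockStarts_quotientSlice {p : Poly} {d : ℕ} (hp : p ∈ H d) {k : ℕ} (hk : k < d) :
    k + 1 ≤ (blockStarts (quotientSlice p k)).card +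
      2 * ∑ i ∈ Finset.range k, (slice p (i + 1)).support.card := by
  induction k with
  | zero =>
    have := (blockStarts_nonempty (quotientSlice_ne_zero hp hk)).card_pos
    omega
  | succ k ih =>
    have h1 := ih (by omega)
    have h2 := card_blockStarts_lt_mul (quotientSlice_ne_zero hp (show k < d by omega))
    have h3 := card_blockStarts_le_sub ((1 + Polynomial.X) * quotientSlice p k) (slice p (k + 1))
    rw [Finset.sum_range_succ, quotientSlice]
    omega

/-- A polynomial in `H(2,d)` has at least `(d + 3) / 2` terms. -/
theorem add_three_le_two_mul_numTerms {p : Poly} {d : ℕ} (hd : 1 ≤ d) (hp : p ∈ H d) :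
    d + 3 ≤ 2 * numTerms p := by
  obtain ⟨k, rfl⟩ : ∃ k, d = k + 1 := ⟨d - 1, by omega⟩
  have h1 := blockStarts_quotientSlice hp (Nat.lt_succ_self k)
  have hne := quotientSlice_ne_zero hp (Nat.lt_succ_self k)
  have h2 := (blockStarts_nonempty hne).card_pos
  have h3 := card_blockStarts_lt_mul hne
  have h4 := card_blockStarts_le ((1 + Polynomial.X) * quotientSlice p k)
  have h5 : (1 + Polynomial.X) * quotientSlice p k = slice p (k + 1) :=
    sub_eq_zero.1 (quotientSlice_eq_zero hp)
  have h6 := sum_card_support_slice_le p (k + 1)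
  rw [Finset.sum_range_succ, Finset.sum_range_succ'] at h6
  rw [h5] at h3 h4
  -- If the last nonzero quotient has B blocks, the top slice has at least B + 1 terms and the
  -- slices of degrees 1 to d - 1 at least (d - B) / 2, so 2 N ≥ d + B + 2 with B ≥ 1.
  omega

/-! ### Monomials in two variables -/

/-- The exponent of `x ^ a * y ^ b`. -/
def expo (a b : ℕ) : Fin 2 →₀ ℕ := Finsupp.single 0 a + Finsupp.single 1 b

@[simp] theorem expo_zero (a b : ℕ) : expo a b 0 = a := by simp [expo]

@[simp] theorem expo_one (a b : ℕ) : expo a b 1 = b := by simp [expo]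

theorem expo_eta (e : Fin 2 →₀ ℕ) : expo (e 0) (e 1) = e := by
  ext i
  fin_cases i <;> simp

theorem expo_inj {a b a' b' : ℕ} : expo a b = expo a' b' ↔ a = a' ∧ b = b' := by
  refine ⟨fun h => ⟨?_, ?_⟩, fun h => by rw [h.1, h.2]⟩
  · simpa using DFunLike.congr_fun h 0
  · simpa using DFunLike.congr_fun h 1

theorem X_pow_mul_X_pow (a b : ℕ) :
    (X 0 ^ a * X 1 ^ b : Poly) = monomial (expo a b) 1 := by
  rw [X_pow_eq_monomial, X_pow_eq_monomial, monomial_mul, one_mul, expo]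

theorem coeff_X_pow_mul_X_pow (a b : ℕ) (e : Fin 2 →₀ ℕ) :
    coeff e (X 0 ^ a * X 1 ^ b : Poly) = if e 0 = a ∧ e 1 = b then 1 else 0 := by
  rw [X_pow_mul_X_pow, coeff_monomial, ← expo_eta e]
  simp only [expo_inj, expo_zero, expo_one, eq_comm]

theorem coeff_expo_swapVars (p : Poly) (a b : ℕ) :
    coeff (expo a b) (swapVars p) = coeff (expo b a) p := by
  have : expo a b = Finsupp.mapDomain (Equiv.swap (0 : Fin 2) 1) (expo b a) := by
    simp [expo, Finsupp.mapDomain_add, Finsupp.mapDomain_single, add_comm]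
  rw [this, swapVars, coeff_rename_mapDomain _ (Equiv.injective _)]

theorem swapVars_swapVars (p : Poly) : swapVars (swapVars p) = p := by
  ext e
  rw [← expo_eta e, coeff_expo_swapVars, coeff_expo_swapVars]

theorem totalDegree_le_of_coeff {p : Poly} {d : ℕ}
    (h : ∀ a b, coeff (expo a b) p ≠ 0 → a + b ≤ d) : p.totalDegree ≤ d := by
  refine Finset.sup_le fun e he => ?_
  rw [Finsupp.sum_fintype _ _ (by simp), Fin.sum_univ_two]
  exact h _ _ (by rw [expo_eta]; exact mem_support_iff.1 he)

theorem totalDegree_eq_of_coeff {p : Poly} {d a b : ℕ}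
    (h : ∀ a b, coeff (expo a b) p ≠ 0 → a + b ≤ d) (hab : a + b = d)
    (hne : coeff (expo a b) p ≠ 0) : p.totalDegree = d := by
  refine (totalDegree_le_of_coeff h).antisymm ?_
  simpa [hab] using degree_le_totalDegree (mem_support_iff.2 hne)

/-! ### The coefficients of the polynomials `f_d` -/

/-- The coefficient of `x ^ (n - 2 i) * y ^ i` in `powerSum n`. -/
def lucasCoeff : ℕ → ℕ → ℕ
  | 0, 0 => 2
  | 0, _ + 1 => 0
  | 1, 0 => 1
  | 1, _ + 1 => 0
  | n + 2, 0 => lucasCoeff (n + 1) 0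
  | n + 2, i + 1 => lucasCoeff (n + 1) (i + 1) + lucasCoeff n i

theorem lucasCoeff_eq_zero (n : ℕ) : ∀ i, n < 2 * i → lucasCoeff n i = 0 := by
  induction n using Nat.twoStepInduction with
  | zero => intro i hi; cases i <;> simp_all [lucasCoeff]
  | one => intro i hi; cases i <;> simp_all [lucasCoeff]
  | more n ih₁ ih₂ =>
    intro i hi
    cases i with
    | zero => omega
    | succ i => rw [lucasCoeff, ih₁ _ (by omega), ih₂ _ (by omega)]

theorem lucasCoeff_zero_right {n : ℕ} (hn : 1 ≤ n) : lucasCoeff n 0 = 1 := by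
  induction n, hn using Nat.le_induction with
  | base => rfl
  | succ n hn ih =>
    obtain ⟨n, rfl⟩ := Nat.exists_eq_add_of_le' hn
    rw [lucasCoeff, ih]

theorem lucasCoeff_pos (n : ℕ) : ∀ i, 2 * i ≤ n → 0 < lucasCoeff n i := by
  induction n using Nat.twoStepInduction with
  | zero => intro i hi; obtain rfl : i = 0 := by omega
            simp [lucasCoeff]
  | one => intro i hi; obtain rfl : i = 0 := by omega
           simp [lucasCoeff]
  | more n ih₁ ih₂ =>
    intro i hi
    cases i with
    | zero => rw [lucasCoeff]; exact ih₂ 0 (by omega)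
    | succ i => rw [lucasCoeff]; have := ih₁ i (by omega); omega

/-- The recurrence is homogeneous when x has weight 1 and y has weight 2. -/
theorem coeff_powerSum (n : ℕ) : ∀ a b, coeff (expo a b) (powerSum n) =
    if a + 2 * b = n then (lucasCoeff n b : ℝ) else 0 := by
  induction n using Nat.twoStepInduction with
  | zero =>
    intro a b
    have : (powerSum 0 : Poly) = C 2 := rfl
    rw [this, coeff_C]
    have h0 : (0 : Fin 2 →₀ ℕ) = expo 0 0 := by simp [expo]
    rw [h0]
    simp only [expo_inj]
    by_cases h : a = 0 ∧ b = 0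
    · simp [h, lucasCoeff]
    · rw [if_neg (by omega), if_neg (by omega)]
  | one =>
    intro a b
    have : (powerSum 1 : Poly) = X 0 ^ 1 * X 1 ^ 0 := by simp [powerSum]
    rw [this, coeff_X_pow_mul_X_pow]
    by_cases h : a = 1 ∧ b = 0
    · simp [h, lucasCoeff]
    · rw [if_neg (by simpa using h), if_neg (by omega)]
  | more n ih₁ ih₂ =>
    intro a b
    have hx : ∀ a b, expo (a + 1) b - Finsupp.single 0 1 = expo a b := by
      intro a b; ext i; fin_cases i <;> simp [expo]
    have hy : ∀ a b, expo a (b + 1) - Finsupp.single 1 1 = expo a b := by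
      intro a b; ext i; fin_cases i <;> simp [expo]
    rw [powerSum, coeff_add, coeff_X_mul', coeff_X_mul']
    simp only [Finsupp.mem_support_iff, expo_zero, expo_one]
    cases a with
    | zero =>
      cases b with
      | zero => simp
      | succ b =>
        rw [if_neg (by simp), if_pos (by simp), hy, ih₁, zero_add]
        by_cases h : 0 + 2 * b = n
        · rw [if_pos h, if_pos (by omega), lucasCoeff,
            lucasCoeff_eq_zero (n + 1) (b + 1) (by omega), zero_add]
        · rw [if_neg h, if_neg (by omega)]
    | succ a =>
      cases b with
      | zero =>
        rw [if_pos (by simp), if_neg (by simp), hx, ih₂, add_zero]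
        by_cases h : a + 2 * 0 = n + 1
        · rw [if_pos h, if_pos (by omega), lucasCoeff]
        · rw [if_neg h, if_neg (by omega)]
      | succ b =>
        rw [if_pos (by simp), if_pos (by simp), hx, hy, ih₁, ih₂]
        by_cases h : a + 2 * (b + 1) = n + 1
        · rw [if_pos h, if_pos (by omega), if_pos (by omega), lucasCoeff, Nat.cast_add]
        · rw [if_neg h, if_neg (by omega), if_neg (by omega), add_zero]

theorem coeff_f (n a b : ℕ) : coeff (expo a b) (f n) =
    (if a + 2 * b = n then (lucasCoeff n b : ℝ) else 0) +
      if a = 0 ∧ b = n then (-1) ^ (n + 1) else 0 := by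
  have : f n = powerSum n + C ((-1) ^ (n + 1)) * (X 0 ^ 0 * X 1 ^ n) := by simp [f]
  rw [this, coeff_add, coeff_powerSum, coeff_C_mul, coeff_X_pow_mul_X_pow]
  simp

/-- The closed form n / (n - i) * binom(n - i, i), with denominators cleared. -/
theorem lucasCoeff_mul_factorial (n : ℕ) : ∀ i, 1 ≤ n → 2 * i ≤ n →
    lucasCoeff n i * i.factorial * (n - 2 * i).factorial = n * (n - i - 1).factorial := by
  induction n using Nat.twoStepInduction with
  | zero => omega
  | one =>
    intro i _ hi
    obtain rfl : i = 0 := by omega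
    simp [lucasCoeff]
  | more n ih₁ ih₂ =>
    intro i _ hi
    cases i with
    | zero =>
      rw [lucasCoeff_zero_right (by omega)]
      simp [Nat.factorial_succ]
    | succ i =>
      rcases Nat.eq_zero_or_pos n with rfl | hn
      · obtain rfl : i = 0 := by omega
        simp [lucasCoeff]
      · have h1 := ih₁ i hn (by omega)
        obtain ⟨r, rfl⟩ := Nat.exists_eq_add_of_le (show 2 * i ≤ n by omega)
        have e1 : 2 * i + r + 2 - 2 * (i + 1) = r := by omega
        have e2 : 2 * i + r + 2 - (i + 1) - 1 = i + r := by omega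
        rw [e1, e2, lucasCoeff]
        rw [Nat.add_sub_cancel_left, show 2 * i + r - i - 1 = i + r - 1 by omega] at h1
        obtain ⟨w, hw⟩ : ∃ w, i + r = w + 1 := ⟨i + r - 1, by omega⟩
        rw [hw, Nat.add_sub_cancel] at h1
        rw [hw]
        have h2 : lucasCoeff (2 * i + r + 1) (i + 1) * (i + 1).factorial * r.factorial =
            r * ((2 * i + r + 1) * w.factorial) := by
          cases r with
          | zero => rw [lucasCoeff_eq_zero _ _ (by omega)]; simp
          | succ r =>
            have h := ih₂ (i + 1) (by omega) (by omega)
            rw [show 2 * i + (r + 1) + 1 - 2 * (i + 1) = r by omega,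
              show 2 * i + (r + 1) + 1 - (i + 1) - 1 = w by omega] at h
            rw [Nat.factorial_succ r, ← h]
            ring
        rw [add_mul, add_mul, h2, Nat.factorial_succ i, Nat.factorial_succ w]
        have : lucasCoeff (2 * i + r) i * ((i + 1) * i.factorial) * r.factorial =
            (i + 1) * ((2 * i + r) * w.factorial) := by
          rw [← h1]; ring
        rw [this, ← hw]
        ring

theorem lucasCoeff_succ_mul {n i : ℕ} (h : 2 * (i + 1) ≤ n) :
    lucasCoeff n (i + 1) * ((i + 1) * (n - i - 1)) =
      lucasCoeff n i * ((n - 2 * i) * (n - 2 * i - 1)) := by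
  have h1 := lucasCoeff_mul_factorial n i (by omega) (by omega)
  have h2 := lucasCoeff_mul_factorial n (i + 1) (by omega) h
  obtain ⟨r, rfl⟩ := Nat.exists_eq_add_of_le h
  rw [show 2 * (i + 1) + r - 2 * i = r + 2 by omega,
    show 2 * (i + 1) + r - i - 1 = i + r + 1 by omega] at *
  rw [show 2 * (i + 1) + r - 2 * (i + 1) = r by omega,
    show 2 * (i + 1) + r - (i + 1) - 1 = i + r by omega] at h2
  rw [show r + 2 - 1 = r + 1 by omega]
  rw [Nat.factorial_succ, Nat.factorial_succ] at h1
  rw [Nat.factorial_succ] at h2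
  rw [Nat.factorial_succ (i + r)] at h1
  apply Nat.eq_of_mul_eq_mul_right (mul_pos i.factorial_pos r.factorial_pos)
  calc _ = (i + r + 1) * (lucasCoeff (2 * (i + 1) + r) (i + 1) * ((i + 1) * i.factorial) *
        r.factorial) := by ring
    _ = (2 * (i + 1) + r) * ((i + r + 1) * (i + r).factorial) := by rw [h2]; ring
    _ = _ := by rw [← h1]; ring

/-! ### Membership of `f_d` in `H(2,d)` -/

/-- On the line, t² = x t + y has roots 1 and -y. -/
theorem eval_powerSum_of_add_eq_one {x y : ℝ} (h : x + y = 1) (n : ℕ) :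
    eval ![x, y] (powerSum n) = 1 + (-y) ^ n := by
  obtain rfl : x = 1 - y := by linarith
  induction n using Nat.twoStepInduction with
  | zero => simp [powerSum]; norm_num
  | one => simp [powerSum]; ring
  | more n ih₁ ih₂ =>
    simp only [powerSum, map_add, map_mul, ih₁, ih₂, eval_X, Matrix.cons_val_zero,
      Matrix.cons_val_one]
    ring

theorem eval_f_of_add_eq_one {x y : ℝ} (h : x + y = 1) (n : ℕ) :
    eval ![x, y] (f n) = 1 := by
  rw [f, map_add, eval_powerSum_of_add_eq_one h]
  simp only [map_mul, map_pow, map_neg, map_one, eval_X, Matrix.cons_val_one,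
    Matrix.cons_val_fin_one]
  rw [neg_pow y n, pow_succ]
  ring

theorem coeff_f_of_odd {d : ℕ} (hd : Odd d) (a b : ℕ) : coeff (expo a b) (f d) =
    if a + 2 * b = d then (lucasCoeff d b : ℝ) else if a = 0 ∧ b = d then 1 else 0 := by
  rw [coeff_f, hd.add_one.neg_one_pow]
  by_cases h : a + 2 * b = d
  · rw [if_pos h, if_pos h, if_neg, add_zero]
    rintro ⟨rfl, rfl⟩
    obtain ⟨r, hr⟩ := hd
    omega
  · rw [if_neg h, if_neg h, zero_add]

theorem f_mem_H {d : ℕ} (hd : Odd d) : f d ∈ H d := by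
  refine ⟨totalDegree_eq_of_coeff (a := 0) (b := d) ?_ (by simp) ?_, fun e => ?_,
    fun x y h => eval_f_of_add_eq_one h d⟩
  · intro a b h
    rw [coeff_f_of_odd hd] at h
    split_ifs at h
    · omega
    · omega
    · exact absurd rfl h
  · rw [coeff_f_of_odd hd]
    have := hd.pos
    rw [if_neg (by omega), if_pos (by simp)]
    exact one_ne_zero
  · rw [← expo_eta e, coeff_f_of_odd hd]
    split_ifs <;> positivity

/-- The exponents of the terms of `f_d`, for odd `d`. -/
def fExponents (d : ℕ) : Finset (Fin 2 →₀ ℕ) :=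
  insert (expo 0 d) ((Finset.range ((d + 1) / 2)).image fun i => expo (d - 2 * i) i)

theorem mem_fExponents {d a b : ℕ} (hd : Odd d) :
    expo a b ∈ fExponents d ↔ a + 2 * b = d ∨ (a = 0 ∧ b = d) := by
  obtain ⟨r, rfl⟩ := hd
  simp only [fExponents, Finset.mem_insert, expo_inj, Finset.mem_image, Finset.mem_range]
  constructor
  · rintro (h | ⟨i, hi, rfl, rfl⟩)
    · exact Or.inr h
    · left; omega
  · rintro (h | h)
    · exact Or.inr ⟨b, by omega, by omega, rfl⟩
    · exact Or.inl h

theorem support_f {d : ℕ} (hd : Odd d) : (f d).support = fExponents d := by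
  ext e
  rw [← expo_eta e, mem_support_iff, mem_fExponents hd, coeff_f_of_odd hd]
  split_ifs with h1 h2
  · simp [h1, (lucasCoeff_pos d (e 1) (by omega)).ne']
  · simp [h2]
  · simp [h1, h2]

theorem two_mul_card_fExponents {d : ℕ} (hd : Odd d) : 2 * (fExponents d).card = d + 3 := by
  classical
  rw [fExponents, Finset.card_insert_of_notMem, Finset.card_image_of_injective, Finset.card_range]
  · obtain ⟨r, rfl⟩ := hd
    omega
  · intro i j h
    exact (expo_inj.1 h).2
  · simp only [Finset.mem_image, Finset.mem_range, expo_inj, not_exists, not_and]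
    intro i hi h1 h2
    omega

/-- The slack of one over the bound d + 3 is harmless by integrality and covers even degrees. -/
theorem isSharp_of_two_mul_numTerms_le {d : ℕ} (hd : 1 ≤ d) {p : Poly} (hp : p ∈ H d)
    (h : 2 * numTerms p ≤ d + 4) : IsSharp d p := by
  refine ⟨hp, fun q hq => ?_⟩
  have h1 := add_three_le_two_mul_numTerms hd hq
  omega

theorem two_mul_numTerms_f {d : ℕ} (hd : Odd d) : 2 * numTerms (f d) = d + 3 := by
  rw [numTerms, support_f hd, two_mul_card_fExponents hd]

theorem isSharp_f {d : ℕ} (hd : Odd d) : IsSharp d (f d) := by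
  have := two_mul_numTerms_f hd
  exact isSharp_of_two_mul_numTerms_le hd.pos (f_mem_H hd) (by omega)

/-! ### Log-convexity of the quotients of coefficients -/

section LogConvex

variable {R ρ : ℕ → ℝ} {s : ℕ}

theorem logConvex_le_of_ratio_eq_one (hpos : ∀ l, l ≤ s → 0 < R l)
    (hR : ∀ l, l < s → R (l + 1) = R l * ρ l) (hρ : ∀ l, l + 1 < s → ρ l < ρ (l + 1))
    {i : ℕ} (hi : i < s) (h1 : ρ i = 1) : ∀ l, l ≤ s → R i ≤ R l := by
  have up : ∀ n, i + n < s → 1 ≤ ρ (i + n) := by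
    intro n
    induction n with
    | zero => intro _; exact h1.ge
    | succ n ih => intro h; exact (ih (by omega)).trans (hρ _ h).le
  have down : ∀ n l, l + n = i → ρ l ≤ 1 := by
    intro n
    induction n with
    | zero => rintro l rfl; exact h1.le
    | succ n ih => intro l h; exact (hρ l (by omega)).le.trans (ih (l + 1) (by omega))
  have hup : ∀ n, i + n ≤ s → R i ≤ R (i + n) := by
    intro n
    induction n with
    | zero => intro _; exact le_rfl
    | succ n ih =>
      intro h
      rw [← add_assoc, hR _ (by omega)]
      exact (ih (by omega)).trans
        (le_mul_of_one_le_right (hpos _ (by omega)).le (up n (by omega)))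
  have hdown : ∀ n l, l + n = i → R i ≤ R l := by
    intro n
    induction n with
    | zero => rintro l rfl; exact le_rfl
    | succ n ih =>
      intro l h
      refine (ih (l + 1) (by omega)).trans ?_
      rw [hR l (by omega)]
      exact mul_le_of_le_one_right (hpos _ (by omega)).le (down (n + 1) l h)
  intro l hl
  rcases le_total i l with h | h
  · obtain ⟨n, rfl⟩ := Nat.exists_eq_add_of_le h
    exact hup n hl
  · obtain ⟨n, hn⟩ := Nat.exists_eq_add_of_le h
    exact hdown n l hn.symm

/-- Minimality at `i` gives a ratio at least 1 there. Were it larger, all later ratios would exceed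
1 and the minimum could not recur. -/
theorem logConvex_ratio_eq_one (hpos : ∀ l, l ≤ s → 0 < R l)
    (hR : ∀ l, l < s → R (l + 1) = R l * ρ l) (hρ : ∀ l, l + 1 < s → ρ l < ρ (l + 1))
    {i i' : ℕ} (hii : i < i') (hi : i' ≤ s) (heq : R i = R i') (hmin : ∀ l, l ≤ s → R i ≤ R l) :
    ρ i = 1 := by
  have h1 : 1 ≤ ρ i := by
    have h := hmin (i + 1) (by omega)
    rw [hR i (by omega)] at h
    exact (le_mul_iff_one_le_right (hpos i (by omega))).1 h
  refine h1.antisymm' (not_lt.1 fun hlt => ?_)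
  have up : ∀ n, i + n < s → 1 < ρ (i + n) := by
    intro n
    induction n with
    | zero => intro _; exact hlt
    | succ n ih => intro h; exact (ih (by omega)).trans (hρ _ h)
  have hup : ∀ n, i + n + 1 ≤ s → R i < R (i + n + 1) := by
    intro n
    induction n with
    | zero =>
      intro h
      rw [add_zero, hR _ (by omega)]
      exact lt_mul_of_one_lt_right (hpos _ (by omega)) hlt
    | succ n ih =>
      intro h
      rw [hR _ (by omega)]
      exact (ih (by omega)).trans
        (lt_mul_of_one_lt_right (hpos _ (by omega)) (up (n + 1) (by omega)))
  obtain ⟨n, rfl⟩ := Nat.exists_eq_add_of_lt hii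
  exact (hup n hi).ne heq

end LogConvex

/-- With `s = l + t + 1` and `d = 2 * s + 2 * k + j`, the factor by which
`lucasCoeff d (k + l) / lucasCoeff (2 * s) l` changes when `l` increases by one. -/
def growth (k j l t : ℕ) : ℝ :=
  ((2 * t + 2 + j) * (2 * t + 1 + j) * ((l + 1) * (2 * t + l + 1))) /
    ((2 * t + 2) * (2 * t + 1) * ((k + l + 1) * (2 * t + l + 1 + k + j)))

/-- The ratio splits into three monotone factors, with an auxiliary factor 2t + l + 3 + j (2t + l +
2 + j on the right) that cancels between the second and third. Only the first factor is strict,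
because `j` is positive. -/
theorem growth_lt {k j l t : ℕ} (hj : 1 ≤ j) : growth k j l (t + 1) < growth k j (l + 1) t := by
  have hj' : (0 : ℝ) < j := by exact_mod_cast hj
  have h1 : (2 * t + 4 + j : ℝ) / (2 * t + 4) < (2 * t + 2 + j) / (2 * t + 2) := by
    rw [div_lt_div_iff₀ (by positivity) (by positivity)]
    nlinarith
  have h2 : ((2 * t + 3 + j) * (2 * t + l + 3) : ℝ) / ((2 * t + 3) * (2 * t + l + 3 + j)) ≤
      ((2 * t + 1 + j) * (2 * t + l + 2)) / ((2 * t + 1) * (2 * t + l + 2 + j)) := by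
    rw [div_le_div_iff₀ (by positivity) (by positivity), ← sub_nonneg]
    ring_nf
    positivity
  have h3 : ((l + 1) * (2 * t + l + 3 + j) : ℝ) / ((k + l + 1) * (2 * t + l + 3 + k + j)) ≤
      ((l + 2) * (2 * t + l + 2 + j)) / ((k + l + 2) * (2 * t + l + 2 + k + j)) := by
    rw [div_le_div_iff₀ (by positivity) (by positivity), ← sub_nonneg]
    ring_nf
    positivity
  have h4 := mul_lt_mul (mul_lt_mul h1 h2 (by positivity) (by positivity)) h3
    (by positivity) (by positivity)
  refine lt_of_eq_of_lt ?_ (lt_of_lt_of_eq h4 ?_)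
  · unfold growth
    push_cast
    rw [div_mul_div_comm, div_mul_div_comm, div_eq_div_iff (by positivity) (by positivity)]
    ring
  · unfold growth
    push_cast
    rw [div_mul_div_comm, div_mul_div_comm, div_eq_div_iff (by positivity) (by positivity)]
    ring

theorem growth_eq_one_iff {k j l t : ℕ} : growth k j l t = 1 ↔
    (2 * t + 2 + j) * (2 * t + 1 + j) * ((l + 1) * (2 * t + l + 1)) =
      (2 * t + 2) * (2 * t + 1) * ((k + l + 1) * (2 * t + l + 1 + k + j)) := by
  rw [growth, div_eq_one_iff_eq (by positivity)]
  exact_mod_cast Iff.rfl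

/-- The quotients of the coefficients of `f_d` and of `x ^ j * y ^ k * f_{2s}`, where
`d = 2 * s + 2 * k + j`. -/
def coeffQuotient (s j k l : ℕ) : ℝ :=
  lucasCoeff (2 * s + 2 * k + j) (k + l) / lucasCoeff (2 * s) l

theorem coeffQuotient_pos {s j k l : ℕ} (hl : l ≤ s) : 0 < coeffQuotient s j k l := by
  have h1 := lucasCoeff_pos (2 * s + 2 * k + j) (k + l) (by omega)
  have h2 := lucasCoeff_pos (2 * s) l (by omega)
  exact div_pos (by exact_mod_cast h1) (by exact_mod_cast h2)

theorem coeffQuotient_succ {s j k l : ℕ} (hl : l < s) :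
    coeffQuotient s j k (l + 1) = coeffQuotient s j k l * growth k j l (s - l - 1) := by
  obtain ⟨t, rfl⟩ := Nat.exists_eq_add_of_lt hl
  rw [show l + t + 1 - l - 1 = t by omega]
  have h1 := lucasCoeff_succ_mul (n := 2 * (l + t + 1) + 2 * k + j) (i := k + l) (by omega)
  have h2 := lucasCoeff_succ_mul (n := 2 * (l + t + 1)) (i := l) (by omega)
  rw [show 2 * (l + t + 1) + 2 * k + j - (k + l) - 1 = 2 * t + l + 1 + k + j by omega,
    show 2 * (l + t + 1) + 2 * k + j - 2 * (k + l) = 2 * t + 2 + j by omega,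
    show 2 * t + 2 + j - 1 = 2 * t + 1 + j by omega] at h1
  rw [show 2 * (l + t + 1) - l - 1 = 2 * t + l + 1 by omega,
    show 2 * (l + t + 1) - 2 * l = 2 * t + 2 by omega,
    show 2 * t + 2 - 1 = 2 * t + 1 by omega] at h2
  have p1 := lucasCoeff_pos (2 * (l + t + 1)) l (by omega)
  have p2 := lucasCoeff_pos (2 * (l + t + 1)) (l + 1) (by omega)
  rw [coeffQuotient, coeffQuotient, growth, ← add_assoc]
  generalize lucasCoeff (2 * (l + t + 1) + 2 * k + j) (k + l) = a at *
  generalize lucasCoeff (2 * (l + t + 1) + 2 * k + j) (k + l + 1) = a' at *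
  generalize lucasCoeff (2 * (l + t + 1)) l = b at *
  generalize lucasCoeff (2 * (l + t + 1)) (l + 1) = b' at *
  have h1' : (a' : ℝ) * ((k + l + 1) * (2 * t + l + 1 + k + j)) =
      a * ((2 * t + 2 + j) * (2 * t + 1 + j)) := by exact_mod_cast h1
  have h2' : (b' : ℝ) * ((l + 1) * (2 * t + l + 1)) =
      b * ((2 * t + 2) * (2 * t + 1)) := by exact_mod_cast h2
  have p1' : (0 : ℝ) < b := by exact_mod_cast p1
  have p2' : (0 : ℝ) < b' := by exact_mod_cast p2
  rw [div_mul_div_comm, div_eq_div_iff p2'.ne' (by positivity)]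
  calc _ = ((a' : ℝ) * ((k + l + 1) * (2 * t + l + 1 + k + j))) *
        (b * ((2 * t + 2) * (2 * t + 1))) := by ring
    _ = _ := by rw [h1', ← h2']; ring

theorem growth_strictMono {s j k l : ℕ} (hj : 1 ≤ j) (hl : l + 1 < s) :
    growth k j l (s - l - 1) < growth k j (l + 1) (s - (l + 1) - 1) := by
  obtain ⟨t, rfl⟩ := Nat.exists_eq_add_of_lt hl
  rw [show l + 1 + t + 1 - l - 1 = t + 1 by omega, show l + 1 + t + 1 - (l + 1) - 1 = t by omega]
  exact growth_lt hj

/-! ### Perturbations of `f_d` for odd `d` -/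

/-- The polynomials formed by the procedure in odd degrees. -/
def perturbation (d m j k : ℕ) (c : ℝ) : Poly :=
  f d - C c * X 0 ^ j * X 1 ^ k * (f m - 1)

theorem coeff_perturbation (d j k : ℕ) {m : ℕ} (hm : Even m) (c : ℝ) (a b : ℕ) :
    coeff (expo a b) (perturbation d m j k c) = coeff (expo a b) (f d) -
      c * ((if j ≤ a ∧ k ≤ b ∧ a + 2 * b = m + j + 2 * k then (lucasCoeff m (b - k) : ℝ) else 0) -
        (if a = j ∧ b = k + m then 1 else 0) - (if a = j ∧ b = k then 1 else 0)) := by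
  have h : perturbation d m j k c = f d - C c * (X 0 ^ j * X 1 ^ k * powerSum m -
      X 0 ^ j * X 1 ^ (k + m) - X 0 ^ j * X 1 ^ k) := by
    rw [perturbation, f, f, hm.add_one.neg_one_pow]
    ring
  rw [h, coeff_sub, coeff_C_mul, coeff_sub, coeff_sub, coeff_X_pow_mul_X_pow,
    coeff_X_pow_mul_X_pow, X_pow_mul_X_pow, coeff_monomial_mul']
  simp only [expo_zero, expo_one]
  congr 4
  have hle : expo j k ≤ expo a b ↔ j ≤ a ∧ k ≤ b := by
    rw [Finsupp.le_def, Fin.forall_fin_two]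
    simp
  have hsub : expo a b - expo j k = expo (a - j) (b - k) := by
    ext i; fin_cases i <;> simp
  rw [hsub, coeff_powerSum]
  by_cases h1 : j ≤ a ∧ k ≤ b
  · rw [if_pos (hle.2 h1), one_mul]
    by_cases h2 : a + 2 * b = m + j + 2 * k
    · rw [if_pos (by omega), if_pos ⟨h1.1, h1.2, h2⟩]
    · rw [if_neg (by omega), if_neg (fun h => h2 h.2.2)]
  · rw [if_neg (fun h => h1 (hle.1 h)), if_neg (fun h => h1 ⟨h.1, h.2.1⟩)]

section Aligned

variable {s j k : ℕ}

theorem coeff_perturbation_of_eq (hj : Odd j) (hs : 1 ≤ s) (c : ℝ) {a b : ℕ}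
    (hab : a + 2 * b = 2 * s + 2 * k + j) :
    coeff (expo a b) (perturbation (2 * s + 2 * k + j) (2 * s) j k c) =
      lucasCoeff (2 * s + 2 * k + j) b -
        if k ≤ b ∧ b ≤ k + s then c * lucasCoeff (2 * s) (b - k) else 0 := by
  have hd : Odd (2 * s + 2 * k + j) := by
    obtain ⟨r, rfl⟩ := hj
    exact ⟨s + k + r, by ring⟩
  rw [coeff_perturbation _ _ _ (even_two_mul s), coeff_f_of_odd hd, if_pos hab,
    if_neg (show ¬(a = j ∧ b = k + 2 * s) by omega), if_neg (show ¬(a = j ∧ b = k) by omega),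
    sub_zero, sub_zero, mul_ite, mul_zero]
  congr 1
  exact if_congr (by omega) rfl rfl

theorem coeff_perturbation_of_ne (hj : Odd j) (c : ℝ) {a b : ℕ}
    (hab : a + 2 * b ≠ 2 * s + 2 * k + j) :
    coeff (expo a b) (perturbation (2 * s + 2 * k + j) (2 * s) j k c) =
      (if a = 0 ∧ b = 2 * s + 2 * k + j then 1 else 0) +
        (if a = j ∧ b = k + 2 * s then c else 0) + if a = j ∧ b = k then c else 0 := by
  have hd : Odd (2 * s + 2 * k + j) := by
    obtain ⟨r, rfl⟩ := hj
    exact ⟨s + k + r, by ring⟩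
  rw [coeff_perturbation _ _ _ (even_two_mul s), coeff_f_of_odd hd, if_neg hab,
    if_neg (show ¬(j ≤ a ∧ k ≤ b ∧ a + 2 * b = 2 * s + j + 2 * k) by omega)]
  split_ifs <;> ring

theorem eval_perturbation {x y : ℝ} (h : x + y = 1) (d m j k : ℕ) (c : ℝ) :
    eval ![x, y] (perturbation d m j k c) = 1 := by
  simp [perturbation, eval_f_of_add_eq_one h]

theorem lucasCoeff_eq_coeffQuotient_mul {l : ℕ} (hl : l ≤ s) :
    (lucasCoeff (2 * s + 2 * k + j) (k + l) : ℝ) =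
      coeffQuotient s j k l * lucasCoeff (2 * s) l := by
  have h2 := lucasCoeff_pos (2 * s) l (by omega)
  rw [coeffQuotient, div_mul_cancel₀]
  exact_mod_cast h2.ne'

/-- If the quotient of coefficients takes its minimum at both `i` and `i + 1`, the corresponding
perturbation of `f_d` is a new sharp polynomial. -/
theorem producesNewSharp_of_growth_eq_one (hj : Odd j) {i : ℕ} (hi : i < s)
    (h1 : growth k j i (s - i - 1) = 1) : ProducesNewSharp (2 * s + 2 * k + j) := by
  classical
  have hd : Odd (2 * s + 2 * k + j) := by
    obtain ⟨r, rfl⟩ := hj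
    exact ⟨s + k + r, by ring⟩
  have hs : 1 ≤ s := by omega
  have hj1 : 1 ≤ j := hj.pos
  have hmin := logConvex_le_of_ratio_eq_one (fun l hl => coeffQuotient_pos (j := j) (k := k) hl)
    (fun l hl => coeffQuotient_succ hl) (fun l hl => growth_strictMono hj1 hl) hi h1
  have hci : coeffQuotient s j k (i + 1) = coeffQuotient s j k i := by
    rw [coeffQuotient_succ hi, h1, mul_one]
  have hc0 := coeffQuotient_pos (j := j) (k := k) hi.le
  set c := coeffQuotient s j k i with hc
  set d := 2 * s + 2 * k + j with hdd
  set p := perturbation d (2 * s) j k c with hp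
  have hzero : ∀ l, l ≤ s → coeffQuotient s j k l = c →
      expo (d - 2 * (k + l)) (k + l) ∉ p.support := by
    intro l hl hlc
    rw [mem_support_iff, not_not, hp, hdd,
      coeff_perturbation_of_eq hj hs c (by omega), if_pos (by omega), Nat.add_sub_cancel_left,
      lucasCoeff_eq_coeffQuotient_mul hl, hlc, sub_self]
  -- Two monomials enter and two leave, so the number of terms does not exceed that of f_d.
  have hsupp : p.support ⊆ insert (expo j k) (insert (expo j (k + 2 * s))
      (fExponents d \ {expo (d - 2 * (k + i)) (k + i),
        expo (d - 2 * (k + (i + 1))) (k + (i + 1))})) := by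
    intro e he
    by_cases hef : e ∈ fExponents d
    · refine Finset.mem_insert_of_mem (Finset.mem_insert_of_mem (Finset.mem_sdiff.2 ⟨hef, ?_⟩))
      simp only [Finset.mem_insert, Finset.mem_singleton, not_or]
      exact ⟨fun h => hzero i hi.le rfl (h ▸ he), fun h => hzero (i + 1) hi hci (h ▸ he)⟩
    · rw [← expo_eta e] at he hef ⊢
      rw [mem_fExponents hd, not_or] at hef
      rw [mem_support_iff, hp, coeff_perturbation_of_ne hj c hef.1, if_neg hef.2, zero_add] at he
      simp only [Finset.mem_insert, expo_inj]
      by_contra hne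
      rw [if_neg (by tauto), if_neg (by tauto), add_zero] at he
      exact he rfl
  have hpH : p ∈ H d := by
    refine ⟨totalDegree_eq_of_coeff (a := 0) (b := d) ?_ (by simp) ?_, fun e => ?_,
      fun x y h => eval_perturbation h _ _ _ _ _⟩
    · intro a b hab
      have := hsupp (mem_support_iff.2 hab)
      simp only [Finset.mem_insert, Finset.mem_sdiff, expo_inj, mem_fExponents hd] at this
      omega
    · rw [hp, coeff_perturbation_of_ne hj c (by omega), if_pos (by omega), if_neg (by omega),
        if_neg (by omega)]
      norm_num
    · rw [← expo_eta e]
      by_cases hw : e 0 + 2 * e 1 = d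
      · rw [hp, coeff_perturbation_of_eq hj hs c hw]
        split_ifs with hb
        · obtain ⟨l, hl⟩ := Nat.exists_eq_add_of_le hb.1
          rw [hl, Nat.add_sub_cancel_left, lucasCoeff_eq_coeffQuotient_mul (by omega), ← sub_mul]
          exact mul_nonneg (sub_nonneg.2 (hmin l (by omega))) (Nat.cast_nonneg _)
        · simp
      · rw [hp, coeff_perturbation_of_ne hj c hw]
        split_ifs <;> positivity
  have hjk : coeff (expo j k) p ≠ 0 := by
    rw [hp, coeff_perturbation_of_ne hj c (by omega), if_neg (by omega), if_neg (by omega),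
      if_pos ⟨rfl, rfl⟩]
    simpa using hc0.ne'
  have hjkm : coeff (expo j (k + 2 * s)) p ≠ 0 := by
    rw [hp, coeff_perturbation_of_ne hj c (by omega), if_neg (by omega), if_pos ⟨rfl, rfl⟩,
      if_neg (by omega)]
    simpa using hc0.ne'
  have hcard : numTerms p ≤ (fExponents d).card := by
    refine (Finset.card_le_card hsupp).trans ((Finset.card_insert_le _ _).trans
      ((Nat.add_le_add_right (Finset.card_insert_le _ _) 1).trans ?_))
    rw [Finset.card_sdiff_of_subset, Finset.card_pair]
    · have := two_mul_card_fExponents hd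
      omega
    · rw [Ne, expo_inj]; omega
    · intro e he
      simp only [Finset.mem_insert, Finset.mem_singleton] at he
      rcases he with rfl | rfl <;> rw [mem_fExponents hd] <;> left <;> omega
  refine ⟨p, Or.inl ⟨hd, 2 * s, j, k, c, even_two_mul s, by omega, rfl⟩,
    isSharp_of_two_mul_numTerms_le hd.pos hpH ?_, ?_, ?_⟩
  · have := two_mul_card_fExponents hd
    omega
  · intro h
    rw [h, ← mem_support_iff, support_f hd, mem_fExponents hd] at hjk
    omega
  -- One new monomial could belong to the swapped f_d, but not both.
  · intro h
    rw [h, coeff_expo_swapVars, ← mem_support_iff, support_f hd, mem_fExponents hd] at hjk hjkm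
    omega

/-- Since f_d competes and two monomials are gained, at least two terms of f_d must vanish.
Nonnegativity makes `c` a lower bound for the quotients, and each vanishing term is an index where
it is attained. -/
theorem exists_growth_eq_one_of_isSharp (hj : Odd j) (hs : 1 ≤ s) {c : ℝ} (hc : 0 < c)
    (hp : IsSharp (2 * s + 2 * k + j) (perturbation (2 * s + 2 * k + j) (2 * s) j k c)) :
    ∃ i, i < s ∧ growth k j i (s - i - 1) = 1 := by
  classical
  have hd : Odd (2 * s + 2 * k + j) := by
    obtain ⟨r, rfl⟩ := hj
    exact ⟨s + k + r, by ring⟩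
  have hj1 : 1 ≤ j := hj.pos
  have hmin : ∀ l, l ≤ s → c ≤ coeffQuotient s j k l := by
    intro l hl
    have h := hp.1.2.1 (expo (2 * s + 2 * k + j - 2 * (k + l)) (k + l))
    rw [coeff_perturbation_of_eq hj hs c (by omega), if_pos (by omega), Nat.add_sub_cancel_left,
      lucasCoeff_eq_coeffQuotient_mul hl, ← sub_mul] at h
    have h2 : (0 : ℝ) < lucasCoeff (2 * s) l := by
      exact_mod_cast lucasCoeff_pos (2 * s) l (by omega)
    exact sub_nonneg.1 (nonneg_of_mul_nonneg_left h h2)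
  have hcard := hp.2 _ (f_mem_H hd)
  rw [numTerms, numTerms, support_f hd] at hcard
  set d := 2 * s + 2 * k + j with hdd
  set p := perturbation d (2 * s) j k c with hpdef
  have hjk : expo j k ∈ p.support \ fExponents d := by
    rw [Finset.mem_sdiff, mem_fExponents hd, mem_support_iff, hpdef,
      coeff_perturbation_of_ne hj c (by omega), if_neg (by omega), if_neg (by omega),
      if_pos ⟨rfl, rfl⟩]
    exact ⟨by simpa using hc.ne', by omega⟩
  have hjkm : expo j (k + 2 * s) ∈ p.support \ fExponents d := by
    rw [Finset.mem_sdiff, mem_fExponents hd, mem_support_iff, hpdef,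
      coeff_perturbation_of_ne hj c (by omega), if_neg (by omega), if_pos ⟨rfl, rfl⟩,
      if_neg (by omega)]
    exact ⟨by simpa using hc.ne', by omega⟩
  have h2 : 1 < (p.support \ fExponents d).card :=
    Finset.one_lt_card.2 ⟨_, hjk, _, hjkm, by rw [Ne, expo_inj]; omega⟩
  have h3 : 1 < (fExponents d \ p.support).card := by
    have e1 := Finset.card_sdiff_add_card_inter p.support (fExponents d)
    have e2 := Finset.card_sdiff_add_card_inter (fExponents d) p.support
    rw [Finset.inter_comm] at e2
    omega
  have hmissing : ∀ e ∈ fExponents d \ p.support, e 0 + 2 * e 1 = d ∧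
      ∃ l, l ≤ s ∧ e 1 = k + l ∧ coeffQuotient s j k l = c := by
    intro e he
    rw [Finset.mem_sdiff, ← expo_eta e, mem_fExponents hd, mem_support_iff, not_not] at he
    by_cases hw : e 0 + 2 * e 1 = d
    · refine ⟨hw, ?_⟩
      have h0 := he.2
      rw [hpdef, coeff_perturbation_of_eq hj hs c hw] at h0
      have hK := lucasCoeff_pos d (e 1) (by omega)
      split_ifs at h0 with hb
      · obtain ⟨l, hl⟩ := Nat.exists_eq_add_of_le hb.1
        refine ⟨l, by omega, hl, ?_⟩
        rw [hl, Nat.add_sub_cancel_left, lucasCoeff_eq_coeffQuotient_mul (by omega), ← sub_mul]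
          at h0
        have h2 : (lucasCoeff (2 * s) l : ℝ) ≠ 0 := by
          exact_mod_cast (lucasCoeff_pos (2 * s) l (by omega)).ne'
        exact sub_eq_zero.1 ((mul_eq_zero.1 h0).resolve_right h2)
      · rw [sub_zero] at h0
        exact absurd h0 (by exact_mod_cast hK.ne')
    -- The term y^d cannot vanish, as its coefficient is at least 1.
    · have h0 := he.2
      rw [hpdef, coeff_perturbation_of_ne hj c hw, if_pos (he.1.resolve_left hw)] at h0
      exfalso
      split_ifs at h0 <;> linarith
  obtain ⟨e, he, e', he', hne⟩ := Finset.one_lt_card.1 h3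
  obtain ⟨hw, l, hl, hel, hlc⟩ := hmissing e he
  obtain ⟨hw', l', hl', hel', hlc'⟩ := hmissing e' he'
  have key : ∀ i i', i < i' → i' ≤ s → coeffQuotient s j k i = c → coeffQuotient s j k i' = c →
      ∃ i, i < s ∧ growth k j i (s - i - 1) = 1 := by
    intro i i' hii hi' h h'
    refine ⟨i, by omega, ?_⟩
    exact logConvex_ratio_eq_one (ρ := fun i => growth k j i (s - i - 1))
      (fun l hl => coeffQuotient_pos (j := j) (k := k) hl)
      (fun l hl => coeffQuotient_succ hl) (fun l hl => growth_strictMono hj1 hl) hii hi'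
      (h.trans h'.symm) (fun l hl => h ▸ hmin l hl)
  rcases lt_trichotomy l l' with h | h | h
  · exact key l l' h hl' hlc hlc'
  · exfalso
    apply hne
    rw [← expo_eta e, ← expo_eta e', expo_inj]
    omega
  · exact key l' l h hl hlc' hlc

end Aligned

theorem exists_aligned_of_perturbation_mem_H {d m j k : ℕ} {c : ℝ} (hd : Odd d) (hm : Even m)
    (hm0 : m ≠ 0) (hc : c ≠ 0) (hp : perturbation d m j k c ∈ H d) :
    0 < c ∧ d = m + 2 * k + j := by
  have hmem : ∀ a b, coeff (expo a b) (f d) ≠ 0 → a + 2 * b = d ∨ (a = 0 ∧ b = d) := by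
    intro a b h
    rwa [← mem_support_iff, support_f hd, mem_fExponents hd] at h
  obtain ⟨r, hr⟩ := hd
  obtain ⟨s, hs⟩ := hm
  -- For negative `c`, both x^j y^k and x^j y^(k+m) would have to be terms of f_d to absorb the
  -- coefficient `c`; for odd `d` and nonzero `m` this is impossible.
  have hcpos : 0 < c := by
    by_contra hcn
    have hcn : c < 0 := lt_of_le_of_ne (not_lt.1 hcn) hc
    have h1 := hp.2.1 (expo j k)
    rw [coeff_perturbation _ _ _ ⟨s, hs⟩, if_neg (by omega), if_neg (by omega),
      if_pos ⟨rfl, rfl⟩] at h1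
    have h2 := hp.2.1 (expo j (k + m))
    rw [coeff_perturbation _ _ _ ⟨s, hs⟩, if_neg (by omega), if_pos ⟨rfl, rfl⟩,
      if_neg (by omega)] at h2
    have h1' := hmem j k (by intro h; rw [h] at h1; linarith)
    have h2' := hmem j (k + m) (by intro h; rw [h] at h2; linarith)
    omega
  refine ⟨hcpos, ?_⟩
  have h1 := hp.2.1 (expo (j + m) k)
  -- The monomial x^(j+m) y^k receives -c, so it must occur in f_d; this fixes `d`.
  rw [coeff_perturbation _ _ _ ⟨s, hs⟩, if_pos (by omega), if_neg (by omega), if_neg (by omega),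
    Nat.sub_self, lucasCoeff_zero_right (by omega)] at h1
  have h1' := hmem (j + m) k (by intro h; rw [h] at h1; norm_num at h1; linarith)
  omega

/-! ### The criterion in odd degrees -/

theorem producesNewSharp_iff_of_odd {d : ℕ} (hd : Odd d) : ProducesNewSharp d ↔
    ∃ t i k j, Odd j ∧ d = 2 * (t + i + 1) + 2 * k + j ∧ growth k j i t = 1 := by
  constructor
  · rintro ⟨p, ⟨-, m, j, k, c, hm, hmd, hp⟩ | ⟨d₁, d₂, -, -, -, h1, h2, h, -⟩, hsharp, hne, -⟩
    · have hp : p = perturbation d m j k c := hp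
      subst hp
      have hc : c ≠ 0 := by
        rintro rfl
        exact hne (by simp [perturbation])
      have hm0 : m ≠ 0 := by
        rintro rfl
        refine hne ?_
        have : f 0 = 1 := by simp [f, powerSum]; norm_num
        simp [perturbation, this]
      obtain ⟨hcpos, hdm⟩ := exists_aligned_of_perturbation_mem_H hd hm hm0 hc hsharp.1
      obtain ⟨s, rfl⟩ := hm.exists_two_nsmul
      rw [smul_eq_mul] at *
      subst hdm
      have hj : Odd j := by
        rcases Nat.even_or_odd j with hj | hj
        · exact absurd hd (Nat.not_odd_iff_even.2
            (((even_two_mul s).add (even_two_mul k)).add hj))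
        · exact hj
      obtain ⟨i, hi, h1⟩ := exists_growth_eq_one_of_isSharp hj (by omega) hcpos hsharp
      exact ⟨s - i - 1, i, k, j, hj, by omega, h1⟩
    · exact absurd (h1.add_odd h2) (Nat.not_even_iff_odd.2 (h ▸ hd))
  · rintro ⟨t, i, k, j, hj, rfl, h1⟩
    refine producesNewSharp_of_growth_eq_one hj (i := i) (by omega) ?_
    rwa [show t + i + 1 - i - 1 = t by omega]

/-- The search for solutions `a = k + i + 1`, `t`, `i` of the equation in `growth_eq_one_iff`. -/
def hasNewSharp (d : ℕ) : Bool :=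
  (List.range (d / 2 + 1)).any fun a => (List.range (d / 2 + 1 - a)).any fun t =>
    -- This says that `j` = d - 2t - 2a is positive. The divisibility test after it is a necessary
    -- condition that spares most searches over `i`.
    Nat.blt (2 * t + 2 * a) d &&
    Nat.beq ((2 * t + 2) * (2 * t + 1) * (a * (d - a)) %
      ((d + 2 - 2 * a) * (d + 1 - 2 * a))) 0 &&
    (List.range a).any fun i =>
      Nat.beq ((d + 2 - 2 * a) * (d + 1 - 2 * a) * ((i + 1) * (2 * t + i + 1)))
        ((2 * t + 2) * (2 * t + 1) * (a * (d - a)))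

theorem hasNewSharp_iff {d : ℕ} (hd : Odd d) : hasNewSharp d = true ↔ ProducesNewSharp d := by
  rw [producesNewSharp_iff_of_odd hd]
  simp only [hasNewSharp, List.any_eq_true, List.mem_range, Bool.and_eq_true, Nat.beq_eq,
    Nat.blt_eq, growth_eq_one_iff]
  constructor
  · rintro ⟨a, ha, t, ht, ⟨hlt, -⟩, i, hi, heq⟩
    obtain ⟨k, rfl⟩ := Nat.exists_eq_add_of_lt hi
    obtain ⟨j, hj⟩ := Nat.exists_eq_add_of_lt hlt
    refine ⟨t, i, k, j + 1, ?_, by omega, ?_⟩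
    · obtain ⟨r, hr⟩ := hd
      exact ⟨r - t - (i + k + 1), by omega⟩
    · rw [show d + 2 - 2 * (i + k + 1) = 2 * t + 2 + (j + 1) by omega,
        show d + 1 - 2 * (i + k + 1) = 2 * t + 1 + (j + 1) by omega,
        show d - (i + k + 1) = 2 * t + i + 1 + k + (j + 1) by omega,
        show i + k + 1 = k + i + 1 by omega] at heq
      exact heq
  · rintro ⟨t, i, k, j, hj, hd', heq⟩
    have := hj.pos
    have e : (d + 2 - 2 * (k + i + 1)) * (d + 1 - 2 * (k + i + 1)) *
        ((i + 1) * (2 * t + i + 1)) =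
        (2 * t + 2) * (2 * t + 1) * ((k + i + 1) * (d - (k + i + 1))) := by
      rw [show d + 2 - 2 * (k + i + 1) = 2 * t + 2 + j by omega,
        show d + 1 - 2 * (k + i + 1) = 2 * t + 1 + j by omega,
        show d - (k + i + 1) = 2 * t + i + 1 + k + j by omega]
      exact heq
    refine ⟨k + i + 1, by omega, t, by omega, ⟨by omega, ?_⟩, i, by omega, e⟩
    rw [← e]
    exact Nat.mul_mod_right _ _

theorem hasNewSharp_eq_notMem : ∀ d < 150, d % 2 = 1 →
    (hasNewSharp d = !decide (d ∈ exceptionalDegrees)) := by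
  decide +kernel

/-! ### Even degrees -/

/-- A polynomial with nonnegative coefficients and the right values whose exponents lie in a small
set is sharp. -/
theorem isSharp_of_support_subset {p : Poly} {d a b : ℕ} (hd : 1 ≤ d) (hab : a + b = d)
    (hne : coeff (expo a b) p ≠ 0) (hnn : ∀ e, 0 ≤ coeff e p)
    (heval : ∀ x y : ℝ, x + y = 1 → eval ![x, y] p = 1) {S : Finset (Fin 2 →₀ ℕ)}
    (hS : p.support ⊆ S) (hdeg : ∀ e ∈ S, e 0 + e 1 ≤ d) (hcard : 2 * S.card ≤ d + 4) :
    IsSharp d p := by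
  refine isSharp_of_two_mul_numTerms_le hd ⟨totalDegree_eq_of_coeff (fun a b h => ?_) hab hne,
    hnn, heval⟩ ?_
  · simpa using hdeg _ (hS (mem_support_iff.2 h))
  · have := Finset.card_le_card hS
    rw [numTerms]
    omega

theorem coeff_X_add_X_mul (p : Poly) (a b : ℕ) : coeff (expo a b) (X 0 + X 1 * p) =
    (if a = 1 ∧ b = 0 then 1 else 0) + if b = 0 then 0 else coeff (expo a (b - 1)) p := by
  have h : (X 0 : Poly) = X 0 ^ 1 * X 1 ^ 0 := by simp
  rw [coeff_add, h, coeff_X_pow_mul_X_pow, coeff_X_mul']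
  have hsub : expo a b - Finsupp.single 1 1 = expo a (b - 1) := by
    ext i; fin_cases i <;> simp [expo]
  simp [hsub]

theorem isSharp_X_add_X_mul_f {n : ℕ} (hn : Odd n) : IsSharp (n + 1) (X 0 + X 1 * f n) := by
  classical
  refine isSharp_of_support_subset (a := 0) (b := n + 1)
    (S := insert (expo 1 0) ((fExponents n).image fun e => expo (e 0) (e 1 + 1)))
    (by omega) (by omega) ?_ (fun e => ?_) (fun x y h => ?_) (fun e he => ?_) (fun e he => ?_) ?_
  · rw [coeff_X_add_X_mul, if_neg (by omega), if_neg (by omega), Nat.add_sub_cancel, zero_add,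
      ← mem_support_iff, support_f hn, mem_fExponents hn]
    simp
  · have := (f_mem_H hn).2.1
    rw [← expo_eta e, coeff_X_add_X_mul]
    have := this (expo (e 0) (e 1 - 1))
    split_ifs <;> positivity
  · simp [eval_f_of_add_eq_one h, h]
  · rw [← expo_eta e, mem_support_iff, coeff_X_add_X_mul] at he
    rw [← expo_eta e]
    by_cases h1 : e 0 = 1 ∧ e 1 = 0
    · rw [h1.1, h1.2]
      exact Finset.mem_insert_self _ _
    · rw [if_neg h1, zero_add] at he
      split_ifs at he with h2
      · exact absurd rfl he
      · refine Finset.mem_insert_of_mem (Finset.mem_image.2 ⟨expo (e 0) (e 1 - 1), ?_, ?_⟩)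
        · rwa [← support_f hn, mem_support_iff]
        · rw [expo_zero, expo_one, Nat.sub_add_cancel (by omega)]
  · rw [Finset.mem_insert, Finset.mem_image] at he
    rcases he with rfl | ⟨e, he, rfl⟩
    · simp
    · rw [← expo_eta e, mem_fExponents hn] at he
      simp only [expo_zero, expo_one]
      omega
  · have h1 := two_mul_card_fExponents hn
    have h2 := Finset.card_insert_le (expo 1 0)
      ((fExponents n).image fun e => expo (e 0) (e 1 + 1))
    have h3 : ((fExponents n).image fun e => expo (e 0) (e 1 + 1)).card ≤ _ :=
      Finset.card_image_le
    omega

theorem coeff_powerSum_add (n a b : ℕ) :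
    coeff (expo a b) (powerSum n + X 1 ^ n * (X 0 + X 1)) =
      (if a + 2 * b = n then (lucasCoeff n b : ℝ) else 0) +
        ((if a = 1 ∧ b = n then 1 else 0) + if a = 0 ∧ b = n + 1 then 1 else 0) := by
  have h : (X 1 ^ n * (X 0 + X 1) : Poly) = X 0 ^ 1 * X 1 ^ n + X 0 ^ 0 * X 1 ^ (n + 1) := by ring
  rw [h, coeff_add, coeff_add, coeff_powerSum, coeff_X_pow_mul_X_pow, coeff_X_pow_mul_X_pow]
  simp

/-- Replacing the term y^n of f_n by y^n (x + y) raises the degree by one at the cost of one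
monomial. -/
theorem isSharp_powerSum_add {n : ℕ} (hn : Odd n) :
    IsSharp (n + 1) (powerSum n + X 1 ^ n * (X 0 + X 1)) := by
  classical
  refine isSharp_of_support_subset (a := 0) (b := n + 1)
    (S := insert (expo 1 n) (insert (expo 0 (n + 1)) ((fExponents n).erase (expo 0 n))))
    (by omega) (by omega) ?_ (fun e => ?_) (fun x y h => ?_) (fun e he => ?_) (fun e he => ?_) ?_
  · rw [coeff_powerSum_add, if_neg (by omega), if_neg (by omega), if_pos (by omega)]
    norm_num
  · rw [← expo_eta e, coeff_powerSum_add]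
    positivity
  · rw [map_add, eval_powerSum_of_add_eq_one h]
    simp [h, hn.neg_pow]
  · rw [← expo_eta e, mem_support_iff, coeff_powerSum_add] at he
    rw [← expo_eta e]
    simp only [Finset.mem_insert, Finset.mem_erase, Ne, expo_inj, mem_fExponents hn]
    by_contra hcon
    rw [if_neg (by have := hn.pos; omega), if_neg (by tauto), if_neg (by tauto)] at he
    simp at he
  · rw [← expo_eta e] at he
    simp only [Finset.mem_insert, Finset.mem_erase, Ne, expo_inj, mem_fExponents hn] at he
    omega
  · have h1 := two_mul_card_fExponents hn
    have h2 := Finset.card_insert_le (expo 1 n)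
      (insert (expo 0 (n + 1)) ((fExponents n).erase (expo 0 n)))
    have h3 := Finset.card_insert_le (expo 0 (n + 1)) ((fExponents n).erase (expo 0 n))
    have h4 := Finset.card_erase_of_mem
      ((mem_fExponents hn).2 (Or.inr ⟨rfl, rfl⟩) : expo 0 n ∈ fExponents n)
    omega

theorem coeff_X_add_X_sq (a b : ℕ) : coeff (expo a b) ((X 0 + X 1) ^ 2 : Poly) =
    (if a = 2 ∧ b = 0 then 1 else 0) + 2 * (if a = 1 ∧ b = 1 then 1 else 0) +
      if a = 0 ∧ b = 2 then 1 else 0 := by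
  have h : ((X 0 + X 1) ^ 2 : Poly) =
      X 0 ^ 2 * X 1 ^ 0 + C 2 * (X 0 ^ 1 * X 1 ^ 1) + X 0 ^ 0 * X 1 ^ 2 := by
    rw [show (C 2 : Poly) = 2 from rfl]
    ring
  rw [h, coeff_add, coeff_add, coeff_C_mul]
  simp only [coeff_X_pow_mul_X_pow, expo_zero, expo_one]

theorem isSharp_X_add_X_sq : IsSharp 2 ((X 0 + X 1) ^ 2 : Poly) := by
  classical
  refine isSharp_of_support_subset (a := 2) (b := 0)
    (S := {expo 2 0, expo 1 1, expo 0 2})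
    (by omega) (by omega) ?_ (fun e => ?_) (fun x y h => ?_) (fun e he => ?_) (fun e he => ?_) ?_
  · rw [coeff_X_add_X_sq]
    norm_num
  · rw [← expo_eta e, coeff_X_add_X_sq]
    positivity
  · simp [h]
  · rw [← expo_eta e, mem_support_iff, coeff_X_add_X_sq] at he
    rw [← expo_eta e]
    simp only [Finset.mem_insert, Finset.mem_singleton, expo_inj]
    by_contra hcon
    rw [if_neg (by tauto), if_neg (by tauto), if_neg (by tauto)] at he
    simp at he
  · simp only [Finset.mem_insert, Finset.mem_singleton] at he
    rcases he with rfl | rfl | rfl <;> simp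
  · have := Finset.card_le_three (a := expo 2 0) (b := expo 1 1) (c := expo 0 2)
    omega

theorem not_uniquenessHolds_of_isSharp {d : ℕ} {p q : Poly} (hp : IsSharp d p)
    (hq : IsSharp d q) (h1 : q ≠ p) (h2 : q ≠ swapVars p) : ¬ UniquenessHolds d := by
  rintro ⟨r, -, hr⟩
  rcases hr p hp with rfl | rfl <;> rcases hr q hq with rfl | rfl
  · exact h1 rfl
  · exact h2 rfl
  · exact h2 (swapVars_swapVars q).symm
  · exact h1 rfl

theorem not_uniquenessHolds_of_even {d : ℕ} (hd : 1 ≤ d) (he : Even d) :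
    ¬ UniquenessHolds d := by
  obtain ⟨n, rfl⟩ : ∃ n, d = n + 1 := ⟨d - 1, by omega⟩
  have hn : Odd n := Nat.not_even_iff_odd.1 (Nat.even_add_one.1 he)
  have hsharp := isSharp_X_add_X_mul_f hn
  have hx : coeff (expo 1 0) (X 0 + X 1 * f n) = 1 := by
    rw [coeff_X_add_X_mul]
    simp
  -- The polynomial x + y f_n contains the monomial x, so one without linear terms x and y differs
  -- from it and from its swap.
  suffices h : ∃ q, IsSharp (n + 1) q ∧ coeff (expo 1 0) q = 0 ∧ coeff (expo 0 1) q = 0 by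
    obtain ⟨q, hq, h1, h2⟩ := h
    refine not_uniquenessHolds_of_isSharp hsharp hq ?_ ?_
    · rintro rfl
      exact one_ne_zero (hx.symm.trans h1)
    · rintro rfl
      rw [coeff_expo_swapVars] at h2
      exact one_ne_zero (hx.symm.trans h2)
  obtain ⟨r, rfl⟩ := hn
  -- For n = 1 the power sum is x itself, so degree 2 needs (x + y)² instead.
  rcases Nat.eq_zero_or_pos r with rfl | hr
  · exact ⟨_, isSharp_X_add_X_sq, by rw [coeff_X_add_X_sq]; simp, by rw [coeff_X_add_X_sq]; simp⟩
  · refine ⟨_, isSharp_powerSum_add ⟨r, rfl⟩, ?_, ?_⟩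
    · rw [coeff_powerSum_add, if_neg (by omega), if_neg (by omega), if_neg (by omega)]
      simp
    · rw [coeff_powerSum_add, if_neg (by omega), if_neg (by omega), if_neg (by omega)]
      simp

theorem coeff_f_of_even {d : ℕ} (hd : 1 ≤ d) (he : Even d) : coeff (expo 0 d) (f d) = -1 := by
  rw [coeff_f, if_neg (by omega), if_pos ⟨rfl, rfl⟩, he.add_one.neg_one_pow, zero_add]

/-- The splitting d = 1 + (d - 1) suffices: it yields x + y f_{d-1}, whereas f_d has the coefficient
-1 at y^d and so is not even in `H d`. -/
theorem producesNewSharp_of_even {d : ℕ} (hd : 1 ≤ d) (he : Even d) : ProducesNewSharp d := by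
  have hf := coeff_f_of_even hd he
  obtain ⟨n, rfl⟩ : ∃ n, d = n + 1 := ⟨d - 1, by omega⟩
  have hn : Odd n := Nat.not_even_iff_odd.1 (Nat.even_add_one.1 he)
  have hsharp := isSharp_X_add_X_mul_f hn
  refine ⟨_, Or.inr ⟨1, n, f 1, f n, 0, odd_one, hn, add_comm _ _, isSharp_f odd_one,
    isSharp_f hn, ?_, ?_⟩, hsharp, ?_, ?_⟩
  · simp [f, powerSum]
  · simp
  · intro h
    have := hsharp.1.2.1 (expo 0 (n + 1))
    rw [h, hf] at this
    linarith
  · intro h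
    have := hsharp.1.2.1 (expo (n + 1) 0)
    rw [h, coeff_expo_swapVars, hf] at this
    linarith

theorem not_uniquenessHolds_of_producesNewSharp {d : ℕ} (hd : Odd d) (h : ProducesNewSharp d) :
    ¬ UniquenessHolds d := by
  obtain ⟨p, -, hp, h1, h2⟩ := h
  exact not_uniquenessHolds_of_isSharp (isSharp_f hd) hp h1 h2

theorem mem_exceptionalDegrees_iff {d : ℕ} (hd : 1 ≤ d) (hd' : d ≤ 149) :
    d ∈ exceptionalDegrees ↔ ¬ ProducesNewSharp d := by
  rcases Nat.even_or_odd d with he | ho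
  · refine iff_of_false (fun h => ?_) (not_not.2 (producesNewSharp_of_even hd he))
    have hodd : ∀ n ∈ exceptionalDegrees, n % 2 = 1 := by decide
    have := hodd d h
    obtain ⟨r, hr⟩ := he
    omega
  · rw [← hasNewSharp_iff ho, hasNewSharp_eq_notMem d (by omega) (Nat.odd_iff.1 ho)]
    simp

end SharpPoly
end

theorem proposition10 :
    (∀ d : ℕ, 1 ≤ d → d ≤ 149 → d ∉ SharpPoly.exceptionalDegrees →
      ¬ SharpPoly.UniquenessHolds d) ∧
    (∀ d : ℕ, 1 ≤ d → d ≤ 149 →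
      (d ∈ SharpPoly.exceptionalDegrees ↔ ¬ SharpPoly.ProducesNewSharp d)) := by
  refine ⟨fun d hd hd' h => ?_, fun d hd hd' => SharpPoly.mem_exceptionalDegrees_iff hd hd'⟩
  rcases Nat.even_or_odd d with he | ho
  · exact SharpPoly.not_uniquenessHolds_of_even hd he
  · rw [SharpPoly.mem_exceptionalDegrees_iff hd hd', not_not] at h
    exact SharpPoly.not_uniquenessHolds_of_producesNewSharp ho h
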